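/- **Conventions.** Fix a universe of small sets. A *Grothendieck topos* is a category equivalent to the category of sheaves of small sets on a small site. A *geometric morphism* $F:\mathcal E\to\mathcal F$ is an adjunction $F^*\dashv F_*$ with $F^*:\mathcal F\to\mathcal E$, $F_*:\mathcal E\to\mathcal F$, such that $F^*$ preserves finite limits. Let $\Sigma$ be a single-sorted first-order signature. A *$\Sigma$-structure* $M$ in a Grothendieck topos consists of an object $M$, a morphism $M^n\to M$ for each $n$-ary function symbol, and a subobject of $M^n$ for each $n$-ary predicate symbol. If $M$ is a $\Sigma$-structure in $\mathcal F$, then $F^*M$ is the $\Sigma$-structure in $\mathcal E$ obtained by applying $F^*$ to all data of $M$, using the canonical isomorphism $F^*(M^n)\cong(F^*M)^n$. A formula $\phi$ (possibly with small infinitary conjunctions and disjunctions) in the variables $x_1,\dots,x_n$ is interpreted as a subobject $[\![\phi]\!]_M\hookrightarrow M^n$ in the usual way: terms are interpreted as morphisms $M^n\to M$; $s=t$ is interpreted as an equalizer; $p(\vec t)$ as a pullback of the interpretation of $p$; $\top,\bot,\wedge,\bigwedge,\bigvee,\to$ by the corresponding operations in the complete Heyting algebra of subobjects of $M^n$; and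 $\exists x$, $\forall x$ by the left and the right adjoint of pullback along the projection $M^{n+1}\to M^n$. The *generalized geometric implications* are the formulas generated by the grammar $$\phi ::= \alpha \mid (\phi_1\wedge\phi_2)\mid \bigvee_{i\in I}\phi_i\mid \exists x.\,\phi\mid\forall x.\,\phi\mid(\alpha\to\phi),$$ where $I$ ranges over small index sets and $\alpha ::= p(\vec t\,)\mid\top\mid\bot\mid s=t$ is atomic. **Theorem.** Let $F:\mathcal E\to\mathcal F$ be a geometric morphism between Grothendieck toposes and let $M$ be a $\Sigma$-structure in $\mathcal F$. For every generalized geometric implication $\phi$ in variables $x_1,\dots,x_n$ there is an inclusion $$F^*[\![\phi]\!]_M\le[\![\phi]\!]_{F^*M}$$ of subobjects of $(F^*M)^n\cong F^*(M^n)$. In particular, if $\phi$ is a sentence and $[\![\phi]\!]_M=\top$, then $[\![\phi]\!]_{F^*M}=\top$. -/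

import Mathlib

open CategoryTheory CategoryTheory.Limits

universe w u v uE vE uF vF

/-! ### Grothendieck toposes -/

/-- A Grothendieck topos (sheaf topos), relative to the universe `w` of small sets: a category
equivalent to the category of sheaves of small sets on a small site. -/
class IsGrothendieckTopos (E : Type uE) [Category.{vE} E] : Prop where
  exists_site : ∃ (C : Type w) (_ : SmallCategory C) (J : GrothendieckTopology C),
    Nonempty (E ≌ Sheaf J (Type w))

namespace IsGrothendieckTopos

/-! The categorical structure on a Grothendieck topos that makes its posets of subobjects
complete lattices, transported from categories of sheaves. -/

section Transport

variable {E : Type uE} [Category.{vE} E] {F : Type uF} [Category.{vF} F]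

theorem hasImages_of_equivalence (e : E ≌ F) [HasImages F] : HasImages E where
  has_image {X Y} f := by
    let G := Image.monoFactorisation (e.functor.map f)
    let L : MonoFactorisation f :=
      { I := e.inverse.obj G.I
        m := e.inverse.map G.m ≫ e.unitInv.app Y
        m_mono := mono_comp _ _
        e := e.unit.app X ≫ e.inverse.map G.e
        fac := by
          rw [Category.assoc, ← e.inverse.map_comp_assoc, G.fac]
          simp }
    refine HasImage.mk ⟨L, ?_⟩
    let up (F' : MonoFactorisation f) : MonoFactorisation (e.functor.map f) :=
      { I := e.functor.obj F'.I
        m := e.functor.map F'.m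
        e := e.functor.map F'.e
        fac := by rw [← e.functor.map_comp, F'.fac] }
    refine
      { lift := fun F' => e.inverse.map (image.lift (up F')) ≫ e.unitInv.app F'.I
        lift_fac := fun F' => ?_ }
    have h : image.lift (up F') ≫ e.functor.map F'.m = G.m := image.lift_fac (up F')
    have h2 := e.unitInv.naturality F'.m
    simp only [Functor.comp_map, Functor.id_map] at h2
    rw [Category.assoc, ← h2, ← e.inverse.map_comp_assoc, h]

theorem initialMonoClass_of_equivalence (e : E ≌ F) [InitialMonoClass F] :
    InitialMonoClass E where
  isInitial_mono_from {I} X hI := by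
    have hI' : IsInitial (e.functor.obj I) := IsInitial.isInitialObj e.functor I hI
    have : Mono (e.functor.map (hI.to X)) := hI'.mono_from _
    exact e.functor.mono_of_mono_map this

theorem wellPowered_of_hasSubobjectClassifier [HasPullbacks E] [LocallySmall.{w} E]
    [HasSubobjectClassifier E] : WellPowered.{w} E where
  subobject_small _ :=
    small_map (HasSubobjectClassifier.exists_classifier.some.representableBy
      (C := E)).homEquiv.symm

end Transport

variable (E : Type uE) [Category.{vE} E] [IsGrothendieckTopos.{w} E]

instance hasLimitsOfSize : HasLimitsOfSize.{w, w} E := by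
  obtain ⟨C, _, J, ⟨e⟩⟩ := exists_site.{w} (E := E)
  exact Adjunction.has_limits_of_equivalence e.functor

instance hasColimitsOfSize : HasColimitsOfSize.{w, w} E := by
  obtain ⟨C, _, J, ⟨e⟩⟩ := exists_site.{w} (E := E)
  have : HasColimitsOfSize.{w, w} (Sheaf J (Type w)) := ⟨fun _ _ => inferInstance⟩
  exact Adjunction.has_colimits_of_equivalence e.functor

instance hasFiniteLimits : HasFiniteLimits E :=
  hasFiniteLimits_of_hasLimitsOfSize.{w, w} E

instance hasWidePullbacks : HasWidePullbacks.{w} E := fun _ => inferInstance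

instance hasCoproducts : HasCoproducts.{w} E := fun _ => inferInstance

instance hasImages : HasImages E := by
  obtain ⟨C, _, J, ⟨e⟩⟩ := exists_site.{w} (E := E)
  exact hasImages_of_equivalence e

instance initialMonoClass : InitialMonoClass E := by
  obtain ⟨C, _, J, ⟨e⟩⟩ := exists_site.{w} (E := E)
  exact initialMonoClass_of_equivalence e

instance locallySmall : LocallySmall.{w} E := by
  obtain ⟨C, _, J, ⟨e⟩⟩ := exists_site.{w} (E := E)
  exact locallySmall_of_faithful e.functor

instance hasSubobjectClassifier : HasSubobjectClassifier E := by
  obtain ⟨C, _, J, ⟨e⟩⟩ := exists_site.{w} (E := E)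
  exact ⟨⟨(HasSubobjectClassifier.exists_classifier
    (C := Sheaf J (Type w))).some.ofEquivalence e.symm⟩⟩

instance wellPowered : WellPowered.{w} E := wellPowered_of_hasSubobjectClassifier

/-! Pullback of subobjects has a right adjoint in every Grothendieck topos. This guarantees that
the suprema defining `⇒` and `∀` below are attained. -/

section RightAdjoint

open Opposite

/-- In a category of sheaves there is a subobject `u` of `Y` through which `t : T ⟶ Y` factors
exactly if the base change of `t` along `f` factors through `a`. -/
theorem exists_forall_sheaf {C : Type w} [SmallCategory C] {J : GrothendieckTopology C}
    {A X Y : Sheaf J (Type w)} (a : A ⟶ X) [Mono a] (f : X ⟶ Y) :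
    ∃ (U : Sheaf J (Type w)) (u : U ⟶ Y), Mono u ∧ ∀ (T : Sheaf J (Type w)) (t : T ⟶ Y),
      (∃ k, k ≫ u = t) ↔ ∀ (Z : Sheaf J (Type w)) (p : Z ⟶ X) (q : Z ⟶ T),
        p ≫ f = q ≫ t → ∃ k, k ≫ a = p := by
  have hXs := (isSheaf_iff_isSheaf_of_type _ _).mp X.property
  have hYs := (isSheaf_iff_isSheaf_of_type _ _).mp Y.property
  have hAs := (isSheaf_iff_isSheaf_of_type _ _).mp A.property
  have hm : Mono a.hom := (Sheaf.Hom.mono_iff_presheaf_mono J (Type w) _).mp inferInstance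
  let A₀ : Subfunctor X.obj := Subfunctor.range a.hom
  have hA₀ : Presieve.IsSheaf J A₀.toFunctor :=
    Presieve.isSheaf_iso J (asIso (Subfunctor.toRange a.hom)) hAs
  have key := (A₀.isSheaf_iff hXs).mp hA₀
  let U₀ : Subfunctor Y.obj :=
    { obj := fun c => {y | ∀ (d : Cᵒᵖ) (h : c ⟶ d) (x : X.obj.obj d),
        f.hom.app d x = Y.obj.map h y → x ∈ A₀.obj d}
      map := fun {c c'} g y hy d h x hx => hy d (g ≫ h) x (by simpa using hx) }
  have hU₀ : Presieve.IsSheaf J U₀.toFunctor := by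
    refine (U₀.isSheaf_iff hYs).mpr fun c s hs d h x hx => key d x ?_
    refine J.superset_covering ?_ (J.pullback_stable h.unop hs)
    intro e k hk
    refine hk (op e) (𝟙 _) _ ?_
    have := NatTrans.naturality_apply f.hom k.op x
    rw [this, hx]
    simp
  refine ⟨⟨U₀.toFunctor, (isSheaf_iff_isSheaf_of_type _ _).mpr hU₀⟩, ⟨U₀.ι⟩, ?_, fun T t => ?_⟩
  · rw [Sheaf.Hom.mono_iff_presheaf_mono]
    dsimp
    infer_instance
  constructor
  · rintro ⟨k, rfl⟩ Z p q hpq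
    have hle : Subfunctor.range p.hom ≤ A₀ := by
      rintro c _ ⟨z, rfl⟩
      refine (k.hom.app c (q.hom.app c z)).2 c (𝟙 c) _ ?_
      have := congr_arg (fun r => r.hom.app c z) hpq
      simpa using this
    refine ⟨⟨Subfunctor.lift p.hom hle ≫ inv (Subfunctor.toRange a.hom)⟩, ?_⟩
    ext : 1
    change (Subfunctor.lift p.hom hle ≫ inv (Subfunctor.toRange a.hom)) ≫ a.hom = p.hom
    have h1 : inv (Subfunctor.toRange a.hom) ≫ a.hom = A₀.ι := by
      rw [IsIso.inv_comp_eq, Subfunctor.toRange_ι]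
    rw [Category.assoc, h1, Subfunctor.lift_ι]
  · intro H
    have hle : Subfunctor.range t.hom ≤ U₀ := by
      rintro c _ ⟨τ, rfl⟩ d h x hx
      obtain ⟨k, hk⟩ := H _ (pullback.fst f t) (pullback.snd f t) pullback.condition
      have hp := ((IsPullback.of_hasPullback f t).map (sheafToPresheaf J (Type w))).map
        ((evaluation _ _).obj d)
      obtain ⟨z, hz1, hz2⟩ := Types.exists_of_isPullback hp x (T.obj.map h τ)
        (hx.trans (NatTrans.naturality_apply t.hom h τ).symm)
      refine ⟨k.hom.app d z, ?_⟩
      have := congr_arg (fun r => r.hom.app d z) hk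
      exact this.trans hz1
    exact ⟨⟨Subfunctor.lift t.hom hle⟩, by ext : 1; rfl⟩

variable {E : Type uE} [Category.{vE} E] [IsGrothendieckTopos.{w} E]

theorem exists_forall {A X Y : E} (a : A ⟶ X) [Mono a] (f : X ⟶ Y) :
    ∃ (U : E) (u : U ⟶ Y), Mono u ∧ ∀ (T : E) (t : T ⟶ Y),
      (∃ k, k ≫ u = t) ↔ ∀ (Z : E) (p : Z ⟶ X) (q : Z ⟶ T),
        p ≫ f = q ≫ t → ∃ k, k ≫ a = p := by
  obtain ⟨C, _, J, ⟨e⟩⟩ := exists_site.{w} (E := E)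
  obtain ⟨U, u, hu, H⟩ := exists_forall_sheaf (e.functor.map a) (e.functor.map f)
  have lft {P Q R : E} (r : P ⟶ R) (s : Q ⟶ R) :
      (∃ k, k ≫ e.functor.map s = e.functor.map r) ↔ ∃ k, k ≫ s = r :=
    ⟨fun ⟨k, hk⟩ => ⟨e.functor.preimage k, e.functor.map_injective (by simpa using hk)⟩,
      fun ⟨k, hk⟩ => ⟨e.functor.map k, by rw [← e.functor.map_comp, hk]⟩⟩
  let u' : e.inverse.obj U ⟶ Y := e.functor.preimage (e.counit.app U ≫ u)
  have hu' : e.functor.map u' = e.counit.app U ≫ u := by simp [u']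
  refine ⟨e.inverse.obj U, u', ?_, fun T t => ?_⟩
  · have : Mono (e.functor.map u') := by rw [hu']; infer_instance
    exact e.functor.mono_of_mono_map this
  rw [← lft, hu']
  have h0 : (∃ k, k ≫ e.counit.app U ≫ u = e.functor.map t) ↔ ∃ k, k ≫ u = e.functor.map t :=
    ⟨fun ⟨k, hk⟩ => ⟨k ≫ e.counit.app U, by simpa using hk⟩,
      fun ⟨k, hk⟩ => ⟨k ≫ e.counitInv.app U, by simpa using hk⟩⟩
  refine h0.trans ((H _ _).trans ?_)
  constructor
  · intro h Z p q hpq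
    rw [← lft]
    exact h _ _ (e.functor.map q) (by rw [← e.functor.map_comp, hpq, e.functor.map_comp])
  · intro h Z p q hpq
    obtain ⟨k, hk⟩ := h (e.inverse.obj Z) (e.functor.preimage (e.counit.app Z ≫ p))
      (e.functor.preimage (e.counit.app Z ≫ q)) (e.functor.map_injective (by simp [hpq]))
    refine ⟨e.counitInv.app Z ≫ e.functor.map k, ?_⟩
    rw [Category.assoc, ← e.functor.map_comp, hk]
    simp

theorem exists_forall_subobject {X Y : E} (f : X ⟶ Y) (A : Subobject X) :
    ∃ U : Subobject Y, ∀ B : Subobject Y, (Subobject.pullback f).obj B ≤ A ↔ B ≤ U := by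
  obtain ⟨U, u, hu, H⟩ := exists_forall.{w} A.arrow f
  refine ⟨Subobject.mk u, fun B => ?_⟩
  have h1 : B ≤ Subobject.mk u ↔ ∃ k, k ≫ u = B.arrow :=
    ⟨fun h => ⟨Subobject.ofLEMk B u h, by simp⟩, fun ⟨k, hk⟩ => Subobject.le_mk_of_comm k hk⟩
  have hp := Subobject.isPullback f B
  rw [h1, H]
  constructor
  · intro h Z p q hpq
    refine ⟨hp.lift q p hpq.symm ≫ Subobject.ofLE _ _ h, ?_⟩
    simp
  · intro h
    obtain ⟨k, hk⟩ := h _ _ _ hp.w.symm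
    exact Subobject.le_of_comm k hk

end RightAdjoint

end IsGrothendieckTopos

/-! ### Geometric morphisms -/

/-- A geometric morphism `E ⟶ F`: an adjunction `inverseImage ⊣ directImage` with
`directImage : E ⥤ F`, whose inverse image part preserves finite limits. -/
structure GeometricMorphism (E : Type uE) [Category.{vE} E] (F : Type uF) [Category.{vF} F] where
  inverseImage : F ⥤ E
  directImage : E ⥤ F
  adj : inverseImage ⊣ directImage
  preservesFiniteLimits : PreservesFiniteLimits inverseImage

attribute [instance] GeometricMorphism.preservesFiniteLimits

noncomputable section

namespace GeometricMorphism

variable {E : Type uE} [Category.{vE} E] {F : Type uF} [Category.{vF} F]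

/-- The action `A ↦ F^* A` of the inverse image functor on subobjects. -/
def inverseImageSub (g : GeometricMorphism E F) {X : F} (A : Subobject X) :
    Subobject (g.inverseImage.obj X) :=
  Subobject.mk (g.inverseImage.map A.arrow)

variable [HasFiniteLimits E] [HasFiniteLimits F]

/-- The canonical isomorphism `F^* (M ^ n) ≅ (F^* M) ^ n`. -/
def powIso (g : GeometricMorphism E F) (M : F) (n : ℕ) :
    g.inverseImage.obj (∏ᶜ fun _ : Fin n => M) ≅ ∏ᶜ fun _ : Fin n => g.inverseImage.obj M :=
  PreservesProduct.iso g.inverseImage fun _ : Fin n => M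

/-- `F^* A`, for `A` a subobject of `M ^ n`, regarded as a subobject of `(F^* M) ^ n` along
the canonical isomorphism `F^* (M ^ n) ≅ (F^* M) ^ n`. -/
def inverseImagePowSub (g : GeometricMorphism E F) {M : F} {n : ℕ}
    (A : Subobject (∏ᶜ fun _ : Fin n => M)) :
    Subobject (∏ᶜ fun _ : Fin n => g.inverseImage.obj M) :=
  (Subobject.map (g.powIso M n).hom).obj (g.inverseImageSub A)

end GeometricMorphism

/-! ### Infinitary first-order formulas -/

/-- Infinitary first-order formulas over a (single-sorted) signature `S` with free variables among
`x₀, …, xₙ₋₁`; conjunctions and disjunctions are indexed by small types. In `all φ` and `ex φ`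
the bound variable is the last variable `xₙ` of `φ`. -/
inductive InfFormula (S : FirstOrder.Language.{u, v}) : ℕ → Type (max u v (w + 1))
  | verum {n : ℕ} : InfFormula S n
  | falsum {n : ℕ} : InfFormula S n
  | eq {n : ℕ} (s t : S.Term (Fin n)) : InfFormula S n
  | rel {n k : ℕ} (P : S.Relations k) (t : Fin k → S.Term (Fin n)) : InfFormula S n
  | and {n : ℕ} (φ ψ : InfFormula S n) : InfFormula S n
  | iAnd {n : ℕ} (I : Type w) (φ : I → InfFormula S n) : InfFormula S n
  | iOr {n : ℕ} (I : Type w) (φ : I → InfFormula S n) : InfFormula S n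
  | imp {n : ℕ} (φ ψ : InfFormula S n) : InfFormula S n
  | all {n : ℕ} (φ : InfFormula S (n + 1)) : InfFormula S n
  | ex {n : ℕ} (φ : InfFormula S (n + 1)) : InfFormula S n

namespace InfFormula

variable {S : FirstOrder.Language.{u, v}}

/-- Atomic formulas: `P(t₁, …, tₖ)`, `⊤`, `⊥` and `s = t`. -/
inductive IsAtomic : {n : ℕ} → InfFormula.{w} S n → Prop
  | verum {n : ℕ} : IsAtomic (verum (n := n))
  | falsum {n : ℕ} : IsAtomic (falsum (n := n))
  | eq {n : ℕ} (s t : S.Term (Fin n)) : IsAtomic (eq s t)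
  | rel {n k : ℕ} (P : S.Relations k) (t : Fin k → S.Term (Fin n)) : IsAtomic (rel P t)

/-- Generalized geometric implications, generated from the atomic formulas by finite conjunctions,
small disjunctions, both quantifiers, and implications with atomic antecedent. -/
inductive IsGeneralizedGeometric : {n : ℕ} → InfFormula.{w} S n → Prop
  | atomic {n : ℕ} {α : InfFormula S n} : α.IsAtomic → IsGeneralizedGeometric α
  | and {n : ℕ} {φ ψ : InfFormula S n} :
      IsGeneralizedGeometric φ → IsGeneralizedGeometric ψ → IsGeneralizedGeometric (and φ ψ)
  | iOr {n : ℕ} {I : Type w} {φ : I → InfFormula S n} :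
      (∀ i, IsGeneralizedGeometric (φ i)) → IsGeneralizedGeometric (iOr I φ)
  | ex {n : ℕ} {φ : InfFormula S (n + 1)} :
      IsGeneralizedGeometric φ → IsGeneralizedGeometric (ex φ)
  | all {n : ℕ} {φ : InfFormula S (n + 1)} :
      IsGeneralizedGeometric φ → IsGeneralizedGeometric (all φ)
  | imp {n : ℕ} {α φ : InfFormula S n} :
      α.IsAtomic → IsGeneralizedGeometric φ → IsGeneralizedGeometric (imp α φ)

end InfFormula

/-! ### Structures in a topos and the interpretation of formulas -/

/-- A structure for the signature `S` in a category with finite products: a carrier `M`, a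
morphism `M ^ n ⟶ M` for every `n`-ary function symbol, and a subobject of `M ^ n` for every
`n`-ary predicate symbol. -/
structure ToposStructure (S : FirstOrder.Language.{u, v}) (E : Type uE) [Category.{vE} E]
    [HasFiniteLimits E] where
  carrier : E
  funMap {n : ℕ} (f : S.Functions n) : (∏ᶜ fun _ : Fin n => carrier) ⟶ carrier
  relMap {n : ℕ} (P : S.Relations n) : Subobject (∏ᶜ fun _ : Fin n => carrier)

/-- The inverse image `F^* M` of a structure `M` along a geometric morphism. -/
def GeometricMorphism.pullStructure {S : FirstOrder.Language.{u, v}}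
    {E : Type uE} [Category.{vE} E] [HasFiniteLimits E]
    {F : Type uF} [Category.{vF} F] [HasFiniteLimits F]
    (g : GeometricMorphism E F) (M : ToposStructure S F) : ToposStructure S E where
  carrier := g.inverseImage.obj M.carrier
  funMap {n} f := (g.powIso M.carrier n).inv ≫ g.inverseImage.map (M.funMap f)
  relMap P := g.inverseImagePowSub (M.relMap P)

section SubobjectOperations

variable {E : Type uE} [Category.{vE} E] [IsGrothendieckTopos.{w} E]

/-- Heyting implication `A ⇒ B` of subobjects: the largest `C` with `C ∧ A ≤ B`. -/
def subImp {X : E} (A B : Subobject X) : Subobject X :=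
  sSup {C | C ⊓ A ≤ B}

/-- Universal quantification `∀_f A` along `f`: the largest subobject whose pullback along `f` is
contained in `A`. -/
def subForall {X Y : E} (f : X ⟶ Y) (A : Subobject X) : Subobject Y :=
  sSup {B | (Subobject.pullback f).obj B ≤ A}

/-- Existential quantification `∃_f A` along `f`: the image of `A` under `f`. -/
def subExists {X Y : E} (f : X ⟶ Y) (A : Subobject X) : Subobject Y :=
  imageSubobject (A.arrow ≫ f)

/-- `∀_f` is right adjoint to pullback along `f`. -/
theorem le_subForall_iff {X Y : E} (f : X ⟶ Y) (A : Subobject X) (B : Subobject Y) :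
    B ≤ subForall.{w} f A ↔ (Subobject.pullback f).obj B ≤ A := by
  obtain ⟨U, hU⟩ := IsGrothendieckTopos.exists_forall_subobject.{w} f A
  have h : subForall.{w} f A = U :=
    le_antisymm (sSup_le fun B hB => (hU B).mp hB) (le_sSup ((hU U).mpr le_rfl))
  rw [h, hU]

/-- `A ⇒ -` is right adjoint to `- ∧ A`. -/
theorem le_subImp_iff {X : E} (A B C : Subobject X) :
    C ≤ subImp.{w} A B ↔ C ⊓ A ≤ B := by
  obtain ⟨U, hU⟩ := IsGrothendieckTopos.exists_forall_subobject.{w} A.arrow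
    ((Subobject.pullback A.arrow).obj B)
  have hU' (D : Subobject X) : D ⊓ A ≤ B ↔ D ≤ U := by
    rw [← hU]
    have hmp (G : Subobject X) :
        (Subobject.map A.arrow).obj ((Subobject.pullback A.arrow).obj G) = A ⊓ G :=
      (Subobject.inf_eq_map_pullback A G).symm
    constructor
    · intro h
      apply leOfHom
      refine ((Subobject.mapPullbackAdj A.arrow).homEquiv _ _) (homOfLE ?_)
      rw [hmp, inf_comm]
      exact h
    · intro h
      have := leOfHom (((Subobject.mapPullbackAdj A.arrow).homEquiv _ _).symm (homOfLE h))
      rwa [hmp, inf_comm] at this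
  have h : subImp.{w} A B = U :=
    le_antisymm (sSup_le fun D hD => (hU' D).mp hD) (le_sSup ((hU' U).mpr le_rfl))
  rw [h, hU']

end SubobjectOperations

namespace ToposStructure

variable {S : FirstOrder.Language.{u, v}} {E : Type uE} [Category.{vE} E]

/-- The interpretation `M ^ n ⟶ M` of a term with variables among `x₀, …, xₙ₋₁`. -/
def term [HasFiniteLimits E] (M : ToposStructure S E) {n : ℕ} :
    S.Term (Fin n) → ((∏ᶜ fun _ : Fin n => M.carrier) ⟶ M.carrier)
  | .var i => Pi.π (fun _ : Fin n => M.carrier) i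
  | .func f ts => Pi.lift (fun i => M.term (ts i)) ≫ M.funMap f

/-- The projection `M ^ (n + 1) ⟶ M ^ n` that forgets the last coordinate. -/
def proj [HasFiniteLimits E] (M : ToposStructure S E) (n : ℕ) :
    (∏ᶜ fun _ : Fin (n + 1) => M.carrier) ⟶ ∏ᶜ fun _ : Fin n => M.carrier :=
  Pi.lift fun i : Fin n => Pi.π (fun _ : Fin (n + 1) => M.carrier) i.castSucc

/-- The interpretation `⟦φ⟧_M`, a subobject of `M ^ n`, of a formula `φ` with free variables among
`x₀, …, xₙ₋₁`. -/
def interp [IsGrothendieckTopos.{w} E] (M : ToposStructure S E) :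
    {n : ℕ} → InfFormula.{w} S n → Subobject (∏ᶜ fun _ : Fin n => M.carrier)
  | _, .verum => ⊤
  | _, .falsum => ⊥
  | _, .eq s t => equalizerSubobject (M.term s) (M.term t)
  | _, .rel P t => (Subobject.pullback (Pi.lift fun i => M.term (t i))).obj (M.relMap P)
  | _, .and φ ψ => M.interp φ ⊓ M.interp ψ
  | _, .iAnd _ φ => ⨅ i, M.interp (φ i)
  | _, .iOr _ φ => ⨆ i, M.interp (φ i)
  | _, .imp φ ψ => subImp (M.interp φ) (M.interp ψ)
  | _, .all φ => subForall (M.proj _) (M.interp φ)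
  | _, .ex φ => subExists (M.proj _) (M.interp φ)

end ToposStructure

end

/-! On subobjects of `M ^ n`, the functor `F^*` is a left adjoint between posets: its right adjoint
pulls `F_* B` back along the transpose of the comparison isomorphism. Hence it is monotone and
preserves all joins, including `⊥`. Left exactness adds `⊤`, binary meets, pullbacks and equalizers.
Consequently atomic formulas are preserved up to equality (`inverseImagePowSub_interp_of_isAtomic`).

For the other connectives a one-sided comparison suffices. Those for `∀` and `→` come from the
adjunctions that define them: `F^*` of the counit is again a counit-type inequality, because `F^*`
commutes with pullback and meets. The antecedent of `→` is contravariant, so the induction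
hypothesis would point the wrong way there; exact preservation of atomic formulas is what makes the
implication case work. -/

namespace CategoryTheory.Subobject

/-! ### Subobjects tested on generalized elements -/

variable {E : Type uE} [Category.{vE} E]

theorem le_iff_factors_arrow {X : E} {A B : Subobject X} : A ≤ B ↔ B.Factors A.arrow :=
  ⟨fun h => factors_of_le _ h (factors_self A),
    fun h => le_of_comm (B.factorThru A.arrow h) (by simp)⟩

theorem le_of_forall_factors {X : E} {A B : Subobject X}
    (h : ∀ {T : E} (t : T ⟶ X), A.Factors t → B.Factors t) : A ≤ B :=
  le_iff_factors_arrow.mpr (h _ (factors_self A))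

theorem factors_iff_exists_arrow {X T : E} {A : Subobject X} {t : T ⟶ X} :
    A.Factors t ↔ ∃ k, k ≫ A.arrow = t :=
  ⟨fun h => ⟨A.factorThru t h, by simp⟩, fun ⟨k, hk⟩ => (factors_iff A t).mpr ⟨k, hk⟩⟩

theorem factors_mk_iff_exists {X Y T : E} {m : Y ⟶ X} [Mono m] {t : T ⟶ X} :
    (mk m).Factors t ↔ ∃ k, k ≫ m = t :=
  mk_factors_iff m t

/-- The universal property of the pullback square, read on generalized elements. -/
theorem pullback_obj_factors_iff [HasPullbacks E] {X Y T : E} {f : X ⟶ Y} {A : Subobject Y}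
    {t : T ⟶ X} : ((pullback f).obj A).Factors t ↔ A.Factors (t ≫ f) := by
  have hp := isPullback f A
  simp only [factors_iff_exists_arrow]
  constructor
  · rintro ⟨k, rfl⟩
    exact ⟨k ≫ pullbackπ f A, by simp [hp.w]⟩
  · rintro ⟨k, hk⟩
    exact ⟨hp.lift k t hk, by simp⟩

end CategoryTheory.Subobject

namespace GeometricMorphism

/-! ### The inverse image on subobjects of powers -/

open Subobject

variable {E : Type uE} [Category.{vE} E] {F : Type uF} [Category.{vF} F]
  [HasFiniteLimits E] [HasFiniteLimits F] (g : GeometricMorphism E F)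

section Pow

variable {M : F} {n : ℕ}

theorem inverseImagePowSub_eq_mk (A : Subobject (∏ᶜ fun _ : Fin n => M)) :
    g.inverseImagePowSub A =
      Subobject.mk (g.inverseImage.map A.arrow ≫ (g.powIso M n).hom) := by
  rw [inverseImagePowSub, inverseImageSub, Subobject.map_mk]

theorem inverseImagePowSub_factors_iff {A : Subobject (∏ᶜ fun _ : Fin n => M)} {T : E}
    {t : T ⟶ ∏ᶜ fun _ : Fin n => g.inverseImage.obj M} :
    (g.inverseImagePowSub A).Factors t ↔
      ∃ k, k ≫ g.inverseImage.map A.arrow = t ≫ (g.powIso M n).inv := by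
  rw [inverseImagePowSub_eq_mk, factors_mk_iff_exists]
  simp only [Iso.eq_comp_inv, Category.assoc]

theorem inverseImagePowSub_le_iff {A : Subobject (∏ᶜ fun _ : Fin n => M)}
    {B : Subobject (∏ᶜ fun _ : Fin n => g.inverseImage.obj M)} :
    g.inverseImagePowSub A ≤ B ↔
      B.Factors (g.inverseImage.map A.arrow ≫ (g.powIso M n).hom) := by
  rw [inverseImagePowSub_eq_mk]
  constructor
  · intro h
    exact factors_of_le _ h (mk_factors_self _)
  · intro h
    exact mk_le_of_comm (B.factorThru _ h) (by simp)

instance mono_directImage_map {X Y : E} (f : X ⟶ Y) [Mono f] : Mono (g.directImage.map f) :=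
  have := g.adj.rightAdjoint_preservesLimits
  inferInstance

/-- The largest subobject of `M ^ n` whose inverse image is contained in `B`: the pullback of
`F_* B` along the transpose of `F^* (M ^ n) ≅ (F^* M) ^ n`. -/
noncomputable def directImagePowSub (B : Subobject (∏ᶜ fun _ : Fin n => g.inverseImage.obj M)) :
    Subobject (∏ᶜ fun _ : Fin n => M) :=
  (Subobject.pullback (g.adj.homEquiv _ _ (g.powIso M n).hom)).obj
    (Subobject.mk (g.directImage.map B.arrow))

/-- Both sides assert a lift through `B`, one in `F` and one in `E`; transposing the lift along `F^*
⊣ F_*`, by naturality of the hom bijection, exchanges them. -/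
theorem directImagePowSub_factors_iff
    {B : Subobject (∏ᶜ fun _ : Fin n => g.inverseImage.obj M)} {T : F}
    {t : T ⟶ ∏ᶜ fun _ : Fin n => M} :
    (g.directImagePowSub B).Factors t ↔
      B.Factors (g.inverseImage.map t ≫ (g.powIso M n).hom) := by
  rw [directImagePowSub, pullback_obj_factors_iff, factors_mk_iff_exists,
    factors_iff_exists_arrow, ← g.adj.homEquiv_naturality_left]
  constructor
  · rintro ⟨k, hk⟩
    refine ⟨(g.adj.homEquiv _ _).symm k, ?_⟩
    rw [← g.adj.homEquiv_naturality_right_symm, hk, Equiv.symm_apply_apply]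
  · rintro ⟨k, hk⟩
    refine ⟨g.adj.homEquiv _ _ k, ?_⟩
    rw [← g.adj.homEquiv_naturality_right, hk]

/-- Both inequalities say that the generic element `A.arrow`, carried into `(F^* M) ^ n`, factors
through `B`. -/
theorem gc_inverseImagePowSub :
    GaloisConnection (g.inverseImagePowSub (M := M) (n := n)) g.directImagePowSub := fun A B => by
  rw [inverseImagePowSub_le_iff, le_iff_factors_arrow, directImagePowSub_factors_iff]

theorem inverseImagePowSub_top :
    g.inverseImagePowSub (⊤ : Subobject (∏ᶜ fun _ : Fin n => M)) = ⊤ := by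
  rw [inverseImagePowSub_eq_mk]
  exact (isIso_iff_mk_eq_top _).mp inferInstance

/-- The direction that needs left exactness: `F^*` preserves the pullback square computing the
intersection. It serves the implication case. -/
theorem inf_inverseImagePowSub_le (A B : Subobject (∏ᶜ fun _ : Fin n => M)) :
    g.inverseImagePowSub A ⊓ g.inverseImagePowSub B ≤ g.inverseImagePowSub (A ⊓ B) := by
  refine le_of_forall_factors fun t ht => ?_
  rw [inf_factors, inverseImagePowSub_factors_iff, inverseImagePowSub_factors_iff] at ht
  obtain ⟨⟨a, ha⟩, b, hb⟩ := ht
  have hp := (IsPullback.of_hasPullback A.arrow B.arrow).map g.inverseImage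
  have hf : (A ⊓ B).Factors (pullback.fst A.arrow B.arrow ≫ A.arrow) := by
    rw [inf_factors]
    refine ⟨factors_comp_arrow _, ?_⟩
    rw [pullback.condition]
    exact factors_comp_arrow _
  rw [inverseImagePowSub_factors_iff]
  refine ⟨hp.lift a b (ha.trans hb.symm) ≫ g.inverseImage.map ((A ⊓ B).factorThru _ hf), ?_⟩
  rw [Category.assoc, ← Functor.map_comp, factorThru_arrow, Functor.map_comp,
    hp.lift_fst_assoc, ha]

/-- `≤` is functoriality; `≥` lifts through the image under `F^*` of the pullback square, which is
again a pullback. -/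
theorem inverseImagePowSub_pullback {M' : F} {k : ℕ}
    {f : (∏ᶜ fun _ : Fin n => M) ⟶ ∏ᶜ fun _ : Fin k => M'}
    {f' : (∏ᶜ fun _ : Fin n => g.inverseImage.obj M) ⟶ ∏ᶜ fun _ : Fin k => g.inverseImage.obj M'}
    (hf : g.inverseImage.map f ≫ (g.powIso M' k).hom = (g.powIso M n).hom ≫ f')
    (A : Subobject (∏ᶜ fun _ : Fin k => M')) :
    g.inverseImagePowSub ((Subobject.pullback f).obj A) =
      (Subobject.pullback f').obj (g.inverseImagePowSub A) := by
  have hf' : f' ≫ (g.powIso M' k).inv = (g.powIso M n).inv ≫ g.inverseImage.map f := by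
    rw [Iso.comp_inv_eq, Category.assoc, hf, Iso.inv_hom_id_assoc]
  apply le_antisymm
  · rw [inverseImagePowSub_le_iff, pullback_obj_factors_iff, Category.assoc, ← hf,
      inverseImagePowSub_factors_iff]
    refine ⟨g.inverseImage.map (pullbackπ f A), ?_⟩
    simp [← Functor.map_comp, (Subobject.isPullback f A).w]
  · refine le_of_forall_factors fun t ht => ?_
    rw [pullback_obj_factors_iff, inverseImagePowSub_factors_iff, Category.assoc, hf',
      ← Category.assoc] at ht
    obtain ⟨k, hk⟩ := ht
    rw [inverseImagePowSub_factors_iff]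
    exact ⟨((Subobject.isPullback f A).map g.inverseImage).lift k _ hk, by simp⟩

theorem inverseImagePowSub_equalizer {X : F} {s t : (∏ᶜ fun _ : Fin n => M) ⟶ X}
    {s' t' : (∏ᶜ fun _ : Fin n => g.inverseImage.obj M) ⟶ g.inverseImage.obj X}
    (hs : g.inverseImage.map s = (g.powIso M n).hom ≫ s')
    (ht : g.inverseImage.map t = (g.powIso M n).hom ≫ t') :
    g.inverseImagePowSub (equalizerSubobject s t) = equalizerSubobject s' t' := by
  apply le_antisymm
  · rw [inverseImagePowSub_le_iff, equalizerSubobject_factors_iff, Category.assoc, Category.assoc,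
      ← hs, ← ht, ← Functor.map_comp, ← Functor.map_comp, equalizerSubobject_arrow_comp]
  · refine le_of_forall_factors fun r hr => ?_
    rw [equalizerSubobject_factors_iff] at hr
    have hr' : (r ≫ (g.powIso M n).inv) ≫ g.inverseImage.map s =
        (r ≫ (g.powIso M n).inv) ≫ g.inverseImage.map t := by
      simp [hs, ht, hr]
    -- By left exactness the image of the equalizer fork is still a limit, so `r`, moved to `F^* (M
    -- ^ n)`, lifts through it.
    have hl := isLimitForkMapOfIsLimit g.inverseImage (equalizer.condition s t)
      (equalizerIsEqualizer s t)
    have hf : (equalizerSubobject s t).Factors (equalizer.ι s t) := by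
      rw [equalizerSubobject_factors_iff, equalizer.condition]
    obtain ⟨k, hk⟩ := Fork.IsLimit.lift' hl _ hr'
    rw [inverseImagePowSub_factors_iff]
    refine ⟨k ≫ g.inverseImage.map ((equalizerSubobject s t).factorThru _ hf), ?_⟩
    rw [Category.assoc, ← Functor.map_comp, factorThru_arrow]
    exact hk

theorem powIso_hom_π (i : Fin n) :
    (g.powIso M n).hom ≫ Pi.π (fun _ : Fin n => g.inverseImage.obj M) i =
      g.inverseImage.map (Pi.π (fun _ : Fin n => M) i) := by
  simp [powIso]

/-- Checked componentwise. It supplies the commuting squares for tuples of terms and for the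
projections under quantifiers. -/
theorem map_lift_powIso_hom {M' : F} {k : ℕ} (f : Fin k → ((∏ᶜ fun _ : Fin n => M) ⟶ M'))
    (f' : Fin k → ((∏ᶜ fun _ : Fin n => g.inverseImage.obj M) ⟶ g.inverseImage.obj M'))
    (hf : ∀ i, g.inverseImage.map (f i) = (g.powIso M n).hom ≫ f' i) :
    g.inverseImage.map (Pi.lift f) ≫ (g.powIso M' k).hom = (g.powIso M n).hom ≫ Pi.lift f' := by
  refine Pi.hom_ext _ _ fun i => ?_
  rw [Category.assoc, powIso_hom_π, ← Functor.map_comp, Pi.lift_π, Category.assoc, Pi.lift_π, hf]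

end Pow

variable {S : FirstOrder.Language.{u, v}} (M : ToposStructure S F)

theorem map_term {n : ℕ} (t : S.Term (Fin n)) :
    g.inverseImage.map (M.term t) =
      (g.powIso M.carrier n).hom ≫ (g.pullStructure M).term t := by
  induction t with
  | var i => exact (g.powIso_hom_π i).symm
  | func f ts ih =>
    have h := g.map_lift_powIso_hom (fun i => M.term (ts i))
      (fun i => (g.pullStructure M).term (ts i)) ih
    simp only [ToposStructure.term, Functor.map_comp]
    -- The function symbols of `F^* M` begin with the inverse comparison isomorphism, which cancels
    -- against the one produced by `h`.
    change _ = (g.powIso M.carrier n).hom ≫ Pi.lift _ ≫ (g.powIso M.carrier _).inv ≫ _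
    rw [← reassoc_of% h, Iso.hom_inv_id_assoc]

theorem map_proj (n : ℕ) :
    g.inverseImage.map (M.proj n) ≫ (g.powIso M.carrier n).hom =
      (g.powIso M.carrier (n + 1)).hom ≫ (g.pullStructure M).proj n :=
  g.map_lift_powIso_hom _ _ fun i => (g.powIso_hom_π i.castSucc).symm

end GeometricMorphism

namespace GeometricMorphism

/-! ### Comparison maps for quantifiers and implication -/

open Subobject

variable {E : Type uE} [Category.{vE} E] [IsGrothendieckTopos.{w} E]
  {F : Type uF} [Category.{vF} F] [IsGrothendieckTopos.{w} F]
  (g : GeometricMorphism E F)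

theorem inverseImagePowSub_subExists_le {M M' : F} {n k : ℕ}
    {f : (∏ᶜ fun _ : Fin n => M) ⟶ ∏ᶜ fun _ : Fin k => M'}
    {f' : (∏ᶜ fun _ : Fin n => g.inverseImage.obj M) ⟶ ∏ᶜ fun _ : Fin k => g.inverseImage.obj M'}
    (hf : g.inverseImage.map f ≫ (g.powIso M' k).hom = (g.powIso M n).hom ≫ f')
    (A : Subobject (∏ᶜ fun _ : Fin n => M)) :
    g.inverseImagePowSub (subExists.{w} f A) ≤ subExists.{w} f' (g.inverseImagePowSub A) := by
  -- Moving to `F` lets minimality of the image there finish the proof, with no need for `F^*` to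
  -- preserve images.
  rw [g.gc_inverseImagePowSub]
  have h : (g.directImagePowSub (subExists.{w} f' (g.inverseImagePowSub A))).Factors
      (A.arrow ≫ f) := by
    have hA : (g.inverseImagePowSub A).Factors
        (g.inverseImage.map A.arrow ≫ (g.powIso M n).hom) :=
      g.inverseImagePowSub_le_iff.mp le_rfl
    obtain ⟨r, hr⟩ := factors_iff_exists_arrow.mp hA
    rw [directImagePowSub_factors_iff, Functor.map_comp, Category.assoc, hf, ← Category.assoc,
      ← hr, Category.assoc]
    exact factors_of_factors_right _ (factors_iff_exists_arrow.mpr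
      ⟨factorThruImageSubobject _, imageSubobject_arrow_comp _⟩)
  exact imageSubobject_le _ (Subobject.factorThru _ _ h) (by simp)

/-- Apply `F^*` to the counit `f^* (∀_f A) ≤ A`, commute it past the pullback, and transpose back.
-/
theorem inverseImagePowSub_subForall_le {M M' : F} {n k : ℕ}
    {f : (∏ᶜ fun _ : Fin n => M) ⟶ ∏ᶜ fun _ : Fin k => M'}
    {f' : (∏ᶜ fun _ : Fin n => g.inverseImage.obj M) ⟶ ∏ᶜ fun _ : Fin k => g.inverseImage.obj M'}
    (hf : g.inverseImage.map f ≫ (g.powIso M' k).hom = (g.powIso M n).hom ≫ f')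
    (A : Subobject (∏ᶜ fun _ : Fin n => M)) :
    g.inverseImagePowSub (subForall.{w} f A) ≤ subForall.{w} f' (g.inverseImagePowSub A) := by
  rw [le_subForall_iff, ← g.inverseImagePowSub_pullback hf]
  exact g.gc_inverseImagePowSub.monotone_l ((le_subForall_iff f A _).mp le_rfl)

/-- Modus ponens `(A ⇒ B) ∧ A ≤ B` survives `F^*`, since `F^*` preserves meets. -/
theorem inverseImagePowSub_subImp_le {M : F} {n : ℕ} (A B : Subobject (∏ᶜ fun _ : Fin n => M)) :
    g.inverseImagePowSub (subImp.{w} A B) ≤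
      subImp.{w} (g.inverseImagePowSub A) (g.inverseImagePowSub B) := by
  rw [le_subImp_iff]
  exact (g.inf_inverseImagePowSub_le _ _).trans
    (g.gc_inverseImagePowSub.monotone_l ((le_subImp_iff A B _).mp le_rfl))

theorem subImp_mono_right {X : E} (A : Subobject X) {B B' : Subobject X} (h : B ≤ B') :
    subImp.{w} A B ≤ subImp.{w} A B' :=
  (le_subImp_iff A B' _).mpr (((le_subImp_iff A B _).mp le_rfl).trans h)

theorem subForall_mono {X Y : E} (f : X ⟶ Y) {A A' : Subobject X} (h : A ≤ A') :
    subForall.{w} f A ≤ subForall.{w} f A' :=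
  (le_subForall_iff f A' _).mpr (((le_subForall_iff f A _).mp le_rfl).trans h)

theorem subExists_mono {X Y : E} (f : X ⟶ Y) {A A' : Subobject X} (h : A ≤ A') :
    subExists.{w} f A ≤ subExists.{w} f A' := by
  unfold subExists
  exact imageSubobject_le _ (Subobject.ofLE A A' h ≫ factorThruImageSubobject (A'.arrow ≫ f)) (by simp)

/-! ### Induction on formulas -/

variable {S : FirstOrder.Language.{u, v}} (M : ToposStructure S F)

theorem inverseImagePowSub_interp_of_isAtomic {n : ℕ} {α : InfFormula.{w} S n} (hα : α.IsAtomic) :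
    g.inverseImagePowSub (M.interp α) = (g.pullStructure M).interp α := by
  cases hα with
  | verum => exact g.inverseImagePowSub_top
  -- The only atomic case that uses the right adjoint rather than left exactness.
  | falsum => exact g.gc_inverseImagePowSub.l_bot
  | eq s t => exact g.inverseImagePowSub_equalizer (g.map_term M s) (g.map_term M t)
  | rel P t =>
    exact g.inverseImagePowSub_pullback
      (g.map_lift_powIso_hom _ _ fun i => g.map_term M (t i)) (M.relMap P)

theorem inverseImagePowSub_interp_le {n : ℕ} {φ : InfFormula.{w} S n}
    (hφ : φ.IsGeneralizedGeometric) :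
    g.inverseImagePowSub (M.interp φ) ≤ (g.pullStructure M).interp φ := by
  induction hφ with
  | atomic hα => exact (g.inverseImagePowSub_interp_of_isAtomic M hα).le
  | and _ _ ih₁ ih₂ =>
    exact (g.gc_inverseImagePowSub.monotone_l.map_inf_le _ _).trans (inf_le_inf ih₁ ih₂)
  | iOr _ ih => exact g.gc_inverseImagePowSub.l_iSup.le.trans (iSup_mono ih)
  | ex _ ih =>
    exact (g.inverseImagePowSub_subExists_le (g.map_proj M _) _).trans (subExists_mono _ ih)
  | all _ ih =>
    exact (g.inverseImagePowSub_subForall_le (g.map_proj M _) _).trans (subForall_mono _ ih)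
  | imp hα _ ih =>
    refine (g.inverseImagePowSub_subImp_le _ _).trans ?_
    -- Replacing the contravariant antecedent requires `⟦α⟧_{F^* M} ≤ F^* ⟦α⟧_M`, the reverse of
    -- what the induction yields.
    rw [g.inverseImagePowSub_interp_of_isAtomic M hα]
    exact subImp_mono_right _ ih

end GeometricMorphism

theorem mainTheorem8
    {E : Type uE} [Category.{vE} E] [IsGrothendieckTopos.{w} E]
    {F : Type uF} [Category.{vF} F] [IsGrothendieckTopos.{w} F]
    (g : GeometricMorphism E F) {S : FirstOrder.Language.{u, v}} (M : ToposStructure S F) :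
    (∀ (n : ℕ) (φ : InfFormula.{w} S n), φ.IsGeneralizedGeometric →
      g.inverseImagePowSub (M.interp φ) ≤ (g.pullStructure M).interp φ) ∧
    (∀ φ : InfFormula.{w} S 0, φ.IsGeneralizedGeometric →
      M.interp φ = ⊤ → (g.pullStructure M).interp φ = ⊤) :=
  ⟨fun _ _ hφ => g.inverseImagePowSub_interp_le M hφ, fun φ hφ h => top_le_iff.mp <| by
    have hle := g.inverseImagePowSub_interp_le M hφ
    rw [h, GeometricMorphism.inverseImagePowSub_top] at hle
    exact hle⟩
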